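/- For a permutation $\sigma=\sigma_1\cdots\sigma_N$ of $\{1,\dots,N\}$ put $\sigma_0=\sigma_{N+1}=0$. For $1\le i\le N$ the letter $\sigma_i$ is a peak if $\sigma_{i-1}<\sigma_i>\sigma_{i+1}$ and a double descent if $\sigma_{i-1}>\sigma_i>\sigma_{i+1}$. A descent is a pair $(\sigma_i,\sigma_{i+1})$ with $1\le i\le N-1$ and $\sigma_i>\sigma_{i+1}$. Let $\mathrm{des}\,\sigma$ and $\mathrm{dd}\,\sigma$ be the numbers of descents and of double descents of $\sigma$; let $\mathrm{lema}\,\sigma$ be the number of even letters $\sigma_i$ such that $\sigma_j<\sigma_i$ for all $1\le j<i$; let $\mathrm{les}\,\sigma$ be the number of pairs $(i,j)$ with $2\le i<j\le N$ and $\sigma_{i-1}>\sigma_j>\sigma_i$; and let $\mathrm{res}\,\sigma$ be the number of pairs $(i,j)$ with $1\le i<j\le N-1$ and $\sigma_{j+1}>\sigma_i>\sigma_j$. For $n\ge 0$ let $\mathcal{Y}^*_{2n+1}$ be the set of permutations of $\{1,\dots,2n+1\}$ whose last letter is odd and in which $\sigma_i$ and $\sigma_{i+1}$ are both odd for every descent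 $(\sigma_i,\sigma_{i+1})$, and let $$Y_n(a,p,q,y,t)=\sum_{\sigma\in\mathcal{Y}^*_{2n+1}}a^{\mathrm{lema}\,\sigma}p^{\mathrm{res}\,\sigma}q^{\mathrm{les}\,\sigma}y^{\mathrm{dd}\,\sigma}t^{\mathrm{des}\,\sigma}.$$ Let $\overline{\mathcal{Y}}^*_{2n+1,k}$ be the set of those $\sigma\in\mathcal{Y}^*_{2n+1}$ with exactly $k$ descents that have no double descent and whose last letter is a peak ($\mathcal{F}$-permutations with $k$ descents). **Theorem.** For every integer $n\ge 0$, $$Y_n(a,p,q,y,t)=\sum_{k=0}^{\lfloor n/2\rfloor}\gamma_{n,k}(a,p,q)\,t^k(1+yt)^{n-2k},\qquad \gamma_{n,k}(a,p,q)=\sum_{\sigma\in\overline{\mathcal{Y}}^*_{2n+1,k}}a^{\mathrm{lema}\,\sigma}p^{\mathrm{res}\,\sigma}q^{\mathrm{les}\,\sigma},$$ as an identity of polynomials; that is, it holds for all elements $a,p,q,y,t$ of every commutative ring. -/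

import Mathlib

namespace OddOdd

open Finset

/-- The word of a permutation of `{1, …, N}` with boundary zeros: for `1 ≤ i ≤ N` this is the
`i`-th letter `σ_i ∈ {1, …, N}` (the element `x : Fin N` stands for the number `x + 1`),
and `σ_0 = σ_{N+1} = 0`. -/
def letter {N : ℕ} (σ : Equiv.Perm (Fin N)) (i : ℕ) : ℕ :=
  if h : 1 ≤ i ∧ i ≤ N then (σ ⟨i - 1, by omega⟩ : ℕ) + 1 else 0

/-- `(σ_i, σ_{i+1})` is a descent; used for `1 ≤ i ≤ N - 1`. -/
abbrev IsDescent {N : ℕ} (σ : Equiv.Perm (Fin N)) (i : ℕ) : Prop :=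
  letter σ i > letter σ (i + 1)

/-- `σ_i` is a peak (with `σ_0 = σ_{N+1} = 0`); used for `1 ≤ i ≤ N`. -/
abbrev IsPeak {N : ℕ} (σ : Equiv.Perm (Fin N)) (i : ℕ) : Prop :=
  letter σ (i - 1) < letter σ i ∧ letter σ i > letter σ (i + 1)

/-- `σ_i` is a double descent (with `σ_0 = σ_{N+1} = 0`); used for `1 ≤ i ≤ N`. -/
abbrev IsDoubleDescent {N : ℕ} (σ : Equiv.Perm (Fin N)) (i : ℕ) : Prop :=
  letter σ (i - 1) > letter σ i ∧ letter σ i > letter σ (i + 1)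

/-- `σ_i` is a left-to-right maximum; used for `1 ≤ i ≤ N`. -/
abbrev IsLeftToRightMax {N : ℕ} (σ : Equiv.Perm (Fin N)) (i : ℕ) : Prop :=
  ∀ j ∈ Ico 1 i, letter σ j < letter σ i

/-- The number of descents. -/
def des {N : ℕ} (σ : Equiv.Perm (Fin N)) : ℕ :=
  #{i ∈ Ico 1 N | IsDescent σ i}

/-- The number of double descents. -/
def dd {N : ℕ} (σ : Equiv.Perm (Fin N)) : ℕ :=
  #{i ∈ Icc 1 N | IsDoubleDescent σ i}

/-- The number of even left-to-right maxima. -/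
def lema {N : ℕ} (σ : Equiv.Perm (Fin N)) : ℕ :=
  #{i ∈ Icc 1 N | IsLeftToRightMax σ i ∧ Even (letter σ i)}

/-- The number of pairs `(i, j)` with `2 ≤ i < j ≤ N` and `σ_{i-1} > σ_j > σ_i`. -/
def les {N : ℕ} (σ : Equiv.Perm (Fin N)) : ℕ :=
  #{x ∈ Icc 2 N ×ˢ Icc 2 N | x.1 < x.2 ∧
    letter σ (x.1 - 1) > letter σ x.2 ∧ letter σ x.2 > letter σ x.1}

/-- The number of pairs `(i, j)` with `1 ≤ i < j ≤ N - 1` and `σ_{j+1} > σ_i > σ_j`. -/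
def res {N : ℕ} (σ : Equiv.Perm (Fin N)) : ℕ :=
  #{x ∈ Ico 1 N ×ˢ Ico 1 N | x.1 < x.2 ∧
    letter σ (x.2 + 1) > letter σ x.1 ∧ letter σ x.1 > letter σ x.2}

/-- `𝒴*_{2n+1}`: the permutations of `{1, …, 2n+1}` all of whose descents are odd-odd
(top and bottom are both odd) and whose last letter is odd. -/
def Ystar (n : ℕ) : Finset (Equiv.Perm (Fin (2 * n + 1))) :=
  {σ | (∀ i ∈ Ico 1 (2 * n + 1), IsDescent σ i → Odd (letter σ i) ∧ Odd (letter σ (i + 1))) ∧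
    Odd (letter σ (2 * n + 1))}

/-- The `𝓕`-permutations: the elements of `𝒴*_{2n+1}` that contain no double descent and whose
last letter is a peak. -/
def FPerm (n : ℕ) : Finset (Equiv.Perm (Fin (2 * n + 1))) :=
  {σ ∈ Ystar n | (∀ i ∈ Icc 1 (2 * n + 1), ¬ IsDoubleDescent σ i) ∧ IsPeak σ (2 * n + 1)}

/-- The `𝓕`-permutations with `k` descents. -/
def FPermDes (n k : ℕ) : Finset (Equiv.Perm (Fin (2 * n + 1))) :=
  {σ ∈ FPerm n | des σ = k}

/-- The enumerative polynomial `Y_n(a,p,q,y,t)`. -/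
def Y {R : Type*} [CommRing R] (n : ℕ) (a p q y t : R) : R :=
  ∑ σ ∈ Ystar n, a ^ lema σ * p ^ res σ * q ^ les σ * y ^ dd σ * t ^ des σ

/-- The polynomial `γ_{n,k}(a,p,q)`, enumerating the `𝓕`-permutations with `k` descents. -/
def gammaCoeff {R : Type*} [CommRing R] (n k : ℕ) (a p q : R) : R :=
  ∑ σ ∈ FPermDes n k, a ^ lema σ * p ^ res σ * q ^ les σ

end OddOdd

/-! If the odd letter `x` is a double ascent, let it hop to the right across the maximal block of
larger letters that follows it; it becomes a double descent, and hopping back is the inverse. No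
other letter changes its type (peak, valley, double ascent or double descent), so the hops of the
odd letters act on `𝒴*_{2n+1}`, whose elements are exactly the permutations with all even letters
double ascents.

A hop preserves `les`, since `les` counts, for each letter `v`, the descents across the level `v`
to the left of `v`: taking `x` out of a monotone step and inserting it into another one does not
change the number of crossings of any other level, and the steps inside the block are above `x`.
Reading words backwards exchanges `res` with `les` and hops to the right with hops to the left. An
even left-to-right maximum stays one because `x` only hops across larger letters and is itself odd.

Every descent ends in a valley or in a double descent, so `y^dd t^des = t^val (yt)^dd`. Summing over
the two positions of each odd letter that can hop gives a factor `1 + yt` for each odd double ascent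
of a permutation without double descents. Such a permutation with `k` descents has `k + 1` peaks and
`k` valleys, all odd, which leaves `n - 2k` of the `n + 1` odd letters as double ascents.
-/

namespace OddOdd

open Finset

section GammaExpansion

/-- A family of involutions `φ i`, each of which exchanges the objects of type `A` at `i` with
those of type `D` at `i` and preserves the types at all other indices. -/
structure IsHopSystem {ι α : Type*} (φ : ι → α → α) (A D : α → ι → Prop) : Prop where
  involutive (i : ι) : Function.Involutive (φ i)
  exchange (i : ι) (s : α) : D (φ i s) i ↔ A s i
  left_iff_of_ne {i j : ι} (hij : j ≠ i) (s : α) : A (φ i s) j ↔ A s j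
  right_iff_of_ne {i j : ι} (hij : j ≠ i) (s : α) : D (φ i s) j ↔ D s j
  disjoint {i : ι} {s : α} (hA : A s i) : ¬ D s i

variable {ι α R : Type*} [CommSemiring R]

lemma sum_mul_ite_eq_of_involutive {φ : α → α} (hφ : Function.Involutive φ) {A D : α → Prop}
    [DecidablePred A] [DecidablePred D] (exchange : ∀ s, D (φ s) ↔ A s)
    (disjoint : ∀ s, A s → ¬ D s) {X : Finset α} (hX : ∀ s ∈ X, φ s ∈ X) {w : α → R}
    (hw : ∀ s, w (φ s) = w s) (z : R) :
    ∑ s ∈ X, w s * (if D s then z else 1) =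
      ∑ s ∈ X with ¬ D s, w s * (if A s then 1 + z else 1) := by
  have trade : ∑ s ∈ X with D s, w s * z = ∑ s ∈ X with A s, w s * z := by
    refine sum_nbij' φ φ (fun s hs => ?_) (fun s hs => ?_) (fun s _ => hφ s) (fun s _ => hφ s)
      fun s _ => by rw [hw]
    · rw [mem_filter] at hs ⊢
      exact ⟨hX s hs.1, by rw [← exchange, hφ s]; exact hs.2⟩
    · rw [mem_filter] at hs ⊢
      exact ⟨hX s hs.1, (exchange s).2 hs.2⟩
  have absorb : ∑ s ∈ X with A s, w s * z =
      ∑ s ∈ X with ¬ D s, if A s then w s * z else 0 := by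
    rw [← sum_filter, filter_filter]
    exact sum_congr (filter_congr fun s _ => ⟨fun h => ⟨disjoint s h, h⟩, And.right⟩) fun _ _ => rfl
  calc ∑ s ∈ X, w s * (if D s then z else 1)
      = ∑ s ∈ X with D s, w s * z + ∑ s ∈ X with ¬ D s, w s := by
        simp only [mul_ite, mul_one, sum_ite]
    _ = ∑ s ∈ X with ¬ D s, ((if A s then w s * z else 0) + w s) := by
        rw [trade, absorb, sum_add_distrib]
    _ = ∑ s ∈ X with ¬ D s, w s * (if A s then 1 + z else 1) := by
        refine sum_congr rfl fun s _ => ?_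
        split_ifs <;> ring

lemma card_filter_insert_of_notMem [DecidableEq ι] {i : ι} {I : Finset ι} (hi : i ∉ I)
    (P : ι → Prop) [DecidablePred P] :
    #{j ∈ insert i I | P j} = #{j ∈ I | P j} + if P i then 1 else 0 := by
  rw [card_filter, sum_insert hi, add_comm, ← card_filter]

theorem IsHopSystem.sum_mul_pow_card_eq {φ : ι → α → α} {A D : α → ι → Prop}
    [∀ s, DecidablePred (A s)] [∀ s, DecidablePred (D s)] (h : IsHopSystem φ A D) (I : Finset ι)
    {X : Finset α} (hX : ∀ i ∈ I, ∀ s ∈ X, φ i s ∈ X) {w : α → R}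
    (hw : ∀ i ∈ I, ∀ s, w (φ i s) = w s) (z : R) :
    ∑ s ∈ X, w s * z ^ #{i ∈ I | D s i} =
      ∑ s ∈ X with ∀ i ∈ I, ¬ D s i, w s * (1 + z) ^ #{i ∈ I | A s i} := by
  classical
  induction I using Finset.induction_on generalizing X w with
  | empty => simp
  | insert x I hx ih =>
    rw [forall_mem_insert] at hX hw
    have ne {i} (hi : i ∈ I) : i ≠ x := ne_of_mem_of_not_mem hi hx
    have card_D (s : α) : #{i ∈ I | D (φ x s) i} = #{i ∈ I | D s i} :=
      congrArg card <| filter_congr fun i hi => h.right_iff_of_ne (ne hi) s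
    calc ∑ s ∈ X, w s * z ^ #{i ∈ insert x I | D s i}
        = ∑ s ∈ X, w s * z ^ #{i ∈ I | D s i} * (if D s x then z else 1) := by
          simp only [card_filter_insert_of_notMem hx, pow_add, pow_ite, pow_one, pow_zero,
            mul_assoc]
      _ = ∑ s ∈ X with ¬ D s x, w s * z ^ #{i ∈ I | D s i} * (if A s x then 1 + z else 1) :=
          sum_mul_ite_eq_of_involutive (h.involutive x) (h.exchange x) (fun _ => h.disjoint) hX.1
            (fun s => by rw [hw.1, card_D]) z
      _ = ∑ s ∈ X with ¬ D s x, w s * (if A s x then 1 + z else 1) * z ^ #{i ∈ I | D s i} := by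
          simp only [mul_right_comm]
      _ = ∑ s ∈ {s ∈ X | ¬ D s x} with ∀ i ∈ I, ¬ D s i,
            w s * (if A s x then 1 + z else 1) * (1 + z) ^ #{i ∈ I | A s i} := by
          refine ih (fun i hi s hs => ?_) (fun i hi s => ?_)
          · rw [mem_filter] at hs ⊢
            rw [h.right_iff_of_ne (ne hi).symm]
            exact ⟨hX.2 i hi s hs.1, hs.2⟩
          · simp only [hw.2 i hi, h.left_iff_of_ne (ne hi).symm]
      _ = ∑ s ∈ X with ∀ i ∈ insert x I, ¬ D s i,
            w s * (1 + z) ^ #{i ∈ insert x I | A s i} := by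
          simp only [card_filter_insert_of_notMem hx, pow_add, pow_ite, pow_one, pow_zero,
            filter_filter, forall_mem_insert, mul_assoc, mul_comm]

end GammaExpansion

section Words

variable {N : ℕ} {σ τ : Equiv.Perm (Fin N)} {v w x : Fin N} {k : ℕ}

/-- The position, in `{1, …, N}`, of the letter `v + 1` in the word of `σ`. Letters are named by
elements `v` of `Fin N`, as in `letter`. -/
def position (σ : Equiv.Perm (Fin N)) (v : Fin N) : ℕ := σ.symm v + 1

lemma letter_val_add_one (σ : Equiv.Perm (Fin N)) (a : Fin N) : letter σ (a + 1) = σ a + 1 := by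
  simp [letter]

lemma letter_of_lt (σ : Equiv.Perm (Fin N)) (h : N < k) : letter σ k = 0 :=
  dif_neg (by omega)

lemma letter_pos_iff : 0 < letter σ k ↔ 1 ≤ k ∧ k ≤ N := by
  unfold letter
  split_ifs with h <;> simp [h]

lemma letter_length_add_one_lt (hN : 1 ≤ N) (σ : Equiv.Perm (Fin N)) :
    letter σ (N + 1) < letter σ N := by
  rw [letter_of_lt σ N.lt_succ_self, letter_pos_iff]
  exact ⟨hN, le_rfl⟩

lemma letter_position (σ : Equiv.Perm (Fin N)) (v : Fin N) : letter σ (position σ v) = v + 1 := by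
  rw [position, letter_val_add_one, Equiv.apply_symm_apply]

lemma one_le_position (σ : Equiv.Perm (Fin N)) (v : Fin N) : 1 ≤ position σ v :=
  Nat.le_add_left 1 _

lemma position_le (σ : Equiv.Perm (Fin N)) (v : Fin N) : position σ v ≤ N :=
  (σ.symm v).isLt

lemma exists_position_eq (σ : Equiv.Perm (Fin N)) (h1 : 1 ≤ k) (hN : k ≤ N) :
    ∃ v, position σ v = k :=
  ⟨σ ⟨k - 1, by omega⟩, by simp [position, Nat.sub_add_cancel h1]⟩

lemma letter_eq_iff : letter σ k = v + 1 ↔ k = position σ v := by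
  refine ⟨fun h => ?_, fun h => h ▸ letter_position σ v⟩
  obtain ⟨h1, hN⟩ := letter_pos_iff.1 (h ▸ Nat.succ_pos _ : 0 < letter σ k)
  obtain ⟨w, rfl⟩ := exists_position_eq σ h1 hN
  rw [letter_position, add_left_inj] at h
  rw [Fin.ext h]

lemma position_injective (σ : Equiv.Perm (Fin N)) : Function.Injective (position σ) :=
  fun _ _ h => σ.symm.injective (Fin.ext (Nat.succ_injective h))

lemma perm_eq_of_letter_eq (h : ∀ k, letter σ k = letter τ k) : σ = τ :=
  Equiv.ext fun a => Fin.ext <| by simpa only [letter_val_add_one, add_left_inj] using h (a + 1)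

lemma forall_mem_Icc_iff_forall_position (σ : Equiv.Perm (Fin N)) {P : ℕ → Prop} :
    (∀ k ∈ Icc 1 N, P k) ↔ ∀ v, P (position σ v) := by
  refine ⟨fun h v => h _ (mem_Icc.2 ⟨one_le_position σ v, position_le σ v⟩), fun h k hk => ?_⟩
  obtain ⟨h1, hN⟩ := mem_Icc.1 hk
  obtain ⟨v, rfl⟩ := exists_position_eq σ h1 hN
  exact h v

lemma card_filter_Icc_eq_card_filter_position (σ : Equiv.Perm (Fin N)) (P : ℕ → Prop)
    [DecidablePred P] : #{k ∈ Icc 1 N | P k} = #{v | P (position σ v)} := by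
  symm
  refine card_bij (fun v _ => position σ v) (fun v hv => ?_)
    (fun v _ w _ h => position_injective σ h) fun k hk => ?_
  · rw [mem_filter] at hv ⊢
    exact ⟨mem_Icc.2 ⟨one_le_position σ v, position_le σ v⟩, hv.2⟩
  · obtain ⟨hk, hP⟩ := mem_filter.1 hk
    obtain ⟨v, rfl⟩ := exists_position_eq σ (mem_Icc.1 hk).1 (mem_Icc.1 hk).2
    exact ⟨v, mem_filter.2 ⟨mem_univ v, hP⟩, rfl⟩

/-- The permutation whose word is the word of `σ` read from right to left. -/
def reverse (σ : Equiv.Perm (Fin N)) : Equiv.Perm (Fin N) := σ * Fin.revPerm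

lemma letter_reverse (σ : Equiv.Perm (Fin N)) (k : ℕ) :
    letter (reverse σ) k = letter σ (N + 1 - k) := by
  by_cases hk : 1 ≤ k ∧ k ≤ N
  · have hk' : 1 ≤ N + 1 - k ∧ N + 1 - k ≤ N := by omega
    simp only [letter, hk, hk', and_self, dif_pos, reverse, Equiv.Perm.mul_apply,
      Fin.revPerm_apply]
    congr 3
    ext
    simp only [Fin.val_rev]
    omega
  · rw [letter, dif_neg hk, letter, dif_neg (by omega)]

lemma reverse_reverse (σ : Equiv.Perm (Fin N)) : reverse (reverse σ) = σ := by
  ext a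
  simp [reverse]

lemma position_reverse (σ : Equiv.Perm (Fin N)) (v : Fin N) :
    position (reverse σ) v = N + 1 - position σ v := by
  have := position_le σ v
  rw [eq_comm, ← letter_eq_iff, letter_reverse, ← letter_position σ v]
  congr 1
  omega

/-- The letter `v + 1` is larger than its left neighbour (with `σ_0 = 0`). -/
abbrev RisesInto (σ : Equiv.Perm (Fin N)) (v : Fin N) : Prop :=
  letter σ (position σ v - 1) < v + 1

/-- The letter `v + 1` is larger than its right neighbour (with `σ_{N+1} = 0`). -/
abbrev FallsFrom (σ : Equiv.Perm (Fin N)) (v : Fin N) : Prop :=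
  letter σ (position σ v + 1) < v + 1

/-- The letter `v + 1` lies between its left neighbour and its larger right neighbour. -/
abbrev IsDoubleAscentLetter (σ : Equiv.Perm (Fin N)) (v : Fin N) : Prop :=
  RisesInto σ v ∧ ¬ FallsFrom σ v

/-- The letter `v + 1` is a double descent in the sense of `IsDoubleDescent`, which refers to
positions instead of letters. -/
abbrev IsDoubleDescentLetter (σ : Equiv.Perm (Fin N)) (v : Fin N) : Prop :=
  ¬ RisesInto σ v ∧ FallsFrom σ v

/-- The letter `v + 1` is smaller than both of its neighbours. -/
abbrev IsValleyLetter (σ : Equiv.Perm (Fin N)) (v : Fin N) : Prop :=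
  ¬ RisesInto σ v ∧ ¬ FallsFrom σ v

lemma not_risesInto_iff : ¬ RisesInto σ v ↔ (v : ℕ) + 1 < letter σ (position σ v - 1) := by
  have := one_le_position σ v
  have ne : letter σ (position σ v - 1) ≠ v + 1 := by
    rw [Ne, letter_eq_iff]
    omega
  omega

lemma risesInto_reverse : RisesInto (reverse σ) v ↔ FallsFrom σ v := by
  have := position_le σ v
  rw [RisesInto, position_reverse, letter_reverse,
    show N + 1 - (N + 1 - position σ v - 1) = position σ v + 1 by omega]

lemma fallsFrom_reverse : FallsFrom (reverse σ) v ↔ RisesInto σ v := by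
  rw [← risesInto_reverse, reverse_reverse]

lemma isDoubleDescent_position_iff :
    IsDoubleDescent σ (position σ v) ↔ IsDoubleDescentLetter σ v := by
  rw [IsDoubleDescentLetter, not_risesInto_iff, IsDoubleDescent, letter_position]

lemma dd_eq_card (σ : Equiv.Perm (Fin N)) : dd σ = #{v | IsDoubleDescentLetter σ v} := by
  simp only [dd, card_filter_Icc_eq_card_filter_position σ, isDoubleDescent_position_iff]

lemma des_eq_card_not_risesInto (σ : Equiv.Perm (Fin N)) : des σ = #{v | ¬ RisesInto σ v} := by
  have bottoms : des σ = #{k ∈ Icc 1 N | letter σ k < letter σ (k - 1)} := by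
    refine card_nbij' (· + 1) (· - 1) (fun k hk => ?_) (fun k hk => ?_)
      (fun k _ => Nat.add_sub_cancel k 1) fun k hk => ?_
    · simp only [coe_filter, mem_Ico, mem_Icc, Set.mem_ofPred_eq, Nat.add_sub_cancel] at hk ⊢
      omega
    all_goals
      simp only [coe_filter, mem_Icc, Set.mem_ofPred_eq] at hk
      have := letter_pos_iff.1 (Nat.zero_lt_of_lt hk.2)
    · simp only [coe_filter, mem_Ico, Set.mem_ofPred_eq, IsDescent, Nat.sub_add_cancel hk.1.1]
      omega
    · exact Nat.sub_add_cancel hk.1.1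
  simp only [bottoms, card_filter_Icc_eq_card_filter_position σ, letter_position,
    not_risesInto_iff]

lemma card_fallsFrom (hN : 1 ≤ N) (σ : Equiv.Perm (Fin N)) : #{v | FallsFrom σ v} = des σ + 1 := by
  have tops := card_filter_Icc_eq_card_filter_position σ fun k => letter σ (k + 1) < letter σ k
  simp only [letter_position] at tops
  rw [← tops, des, ← Ico_insert_right hN, filter_insert, if_pos (letter_length_add_one_lt hN σ),
    card_insert_of_notMem (by simp)]

lemma des_eq_card_valley_add_dd (σ : Equiv.Perm (Fin N)) :
    des σ = #{v | IsValleyLetter σ v} + dd σ := by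
  rw [des_eq_card_not_risesInto, dd_eq_card, add_comm, ← filter_filter, ← filter_filter,
    card_filter_add_card_filter_not]

lemma forall_descentTop_iff (hN : 1 ≤ N) (P : ℕ → Prop) :
    ((∀ k ∈ Ico 1 N, IsDescent σ k → P (letter σ k)) ∧ P (letter σ N)) ↔
      ∀ v, FallsFrom σ v → P (v + 1) := by
  have := forall_mem_Icc_iff_forall_position σ
    (P := fun k => letter σ (k + 1) < letter σ k → P (letter σ k))
  simp only [letter_position] at this
  rw [← this, ← Ico_insert_right hN, forall_mem_insert, and_comm,
    forall_prop_of_true (letter_length_add_one_lt hN σ)]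

lemma forall_descentBottom_iff (P : ℕ → Prop) :
    (∀ k ∈ Ico 1 N, IsDescent σ k → P (letter σ (k + 1))) ↔
      ∀ v, ¬ RisesInto σ v → P (v + 1) := by
  have := forall_mem_Icc_iff_forall_position σ
    (P := fun k => letter σ k < letter σ (k - 1) → P (letter σ k))
  simp only [letter_position, ← not_risesInto_iff] at this
  rw [← this]
  constructor
  · intro h k hk hd
    obtain ⟨h1, hN⟩ := mem_Icc.1 hk
    have := letter_pos_iff.1 (Nat.zero_lt_of_lt hd)
    have hs := Nat.sub_add_cancel h1
    have := h (k - 1) (mem_Ico.2 (by omega))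
    rw [IsDescent, hs] at this
    exact this hd
  · intro h k hk hd
    exact h (k + 1) (mem_Icc.2 (by have := mem_Ico.1 hk; omega)) hd

/-! ### Hops over a block of larger letters -/

/-- `τ` arises from `σ` by moving the letter `x + 1` to the right, past the maximal block of larger
letters that follows it, where the letter before `x + 1` in `σ` is smaller. -/
structure Hop (x : Fin N) (σ τ : Equiv.Perm (Fin N)) : Prop where
  position_lt : position σ x < position τ x
  risesInto : RisesInto σ x
  fallsFrom : FallsFrom τ x
  lt_letter ⦃k : ℕ⦄ : position σ x < k → k ≤ position τ x → (x : ℕ) + 1 < letter σ k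
  letter_outside ⦃k : ℕ⦄ : k < position σ x ∨ position τ x < k → letter τ k = letter σ k
  letter_shift ⦃k : ℕ⦄ : position σ x ≤ k → k < position τ x → letter τ k = letter σ (k + 1)

lemma exists_block_end (hA : IsDoubleAscentLetter σ x) :
    ∃ w, position σ x < position σ w ∧ letter σ (position σ w + 1) < x + 1 ∧
      ∀ k, position σ x < k → k ≤ position σ w → (x : ℕ) + 1 < letter σ k := by
  classical
  have drops_at_end : position σ x < N + 1 ∧ letter σ (N + 1) < x + 1 :=
    ⟨Nat.lt_succ_of_le (position_le σ x), by simp [letter_of_lt σ N.lt_succ_self]⟩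
  have drops : ∃ k, position σ x < k ∧ letter σ k < x + 1 := ⟨N + 1, drops_at_end⟩
  obtain ⟨hpos, hlt⟩ := Nat.find_spec drops
  have hle : Nat.find drops ≤ N + 1 := Nat.find_min' drops drops_at_end
  have hne : Nat.find drops ≠ position σ x + 1 := fun h => hA.2 (by rwa [h] at hlt)
  obtain ⟨w, hw⟩ := exists_position_eq σ (k := Nat.find drops - 1) (by omega) (by omega)
  refine ⟨w, by omega, ?_, fun k hk hk' => ?_⟩
  · rwa [hw, Nat.sub_add_cancel (by omega)]
  · have hmin := Nat.find_min drops (m := k) (by omega)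
    have : letter σ k ≠ x + 1 := by
      rw [Ne, letter_eq_iff]
      omega
    omega

lemma letter_mul_cycleIcc (h : position σ v ≤ position σ w) (k : ℕ) :
    letter (σ * Fin.cycleIcc (σ.symm v) (σ.symm w)) k =
      if k < position σ v ∨ position σ w < k then letter σ k
      else if k = position σ w then (v : ℕ) + 1 else letter σ (k + 1) := by
  have : NeZero N := ⟨v.pos.ne'⟩
  unfold position at h ⊢
  by_cases hk : 1 ≤ k ∧ k ≤ N
  · obtain ⟨c, rfl⟩ : ∃ c : Fin N, k = c + 1 :=
      ⟨⟨k - 1, by omega⟩, (Nat.sub_add_cancel hk.1).symm⟩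
    rw [letter_val_add_one, Equiv.Perm.mul_apply]
    split_ifs with hout hend
    · rcases hout with hlt | hgt
      · rw [Fin.cycleIcc_of_lt (Fin.lt_def.2 (by omega)), letter_val_add_one]
      · rw [Fin.cycleIcc_of_gt (Fin.lt_def.2 (by omega)), letter_val_add_one]
    · obtain rfl : c = σ.symm w := Fin.ext (by omega)
      rw [Fin.cycleIcc_of_last (Fin.le_def.2 (by omega)), Equiv.apply_symm_apply]
    · have hlt : c < σ.symm w := Fin.lt_def.2 (by omega)
      rw [Fin.cycleIcc_of_ge_of_lt (Fin.le_def.2 (by omega)) hlt, ← letter_val_add_one,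
        Fin.val_add_one_of_lt' (by omega)]
  · rw [if_pos (by omega), letter, dif_neg hk, letter, dif_neg hk]

lemma exists_hop_of_isDoubleAscentLetter (hA : IsDoubleAscentLetter σ x) : ∃ τ, Hop x σ τ := by
  obtain ⟨w, hlt, hright, hblock⟩ := exists_block_end hA
  have letter_eq := letter_mul_cycleIcc hlt.le
  refine ⟨σ * Fin.cycleIcc (σ.symm x) (σ.symm w), ?_⟩
  generalize σ * Fin.cycleIcc (σ.symm x) (σ.symm w) = τ at letter_eq ⊢
  have position_eq : position τ x = position σ w := by
    rw [eq_comm, ← letter_eq_iff, letter_eq, if_neg (by omega), if_pos rfl]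
  refine ⟨by rwa [position_eq], hA.1, ?_, by rwa [position_eq], fun k hk => ?_, fun k hk hk' => ?_⟩
  · rwa [FallsFrom, position_eq, letter_eq, if_pos (by omega)]
  · rw [letter_eq, if_pos (by omega)]
  · rw [letter_eq, if_neg (by omega), if_neg (by omega)]

namespace Hop

lemma lt_letter_target (h : Hop x σ τ) (hk : position σ x ≤ k) (hk' : k < position τ x) :
    (x : ℕ) + 1 < letter τ k := by
  rw [h.letter_shift hk hk']
  exact h.lt_letter (by omega) (by omega)

lemma letter_right_source (h : Hop x σ τ) : letter σ (position τ x + 1) < x + 1 := by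
  rw [← h.letter_outside (by omega)]
  exact h.fallsFrom

lemma isDoubleAscentLetter (h : Hop x σ τ) : IsDoubleAscentLetter σ x :=
  ⟨h.risesInto, (h.lt_letter (Nat.lt_succ_self _) h.position_lt).not_gt⟩

lemma isDoubleDescentLetter (h : Hop x σ τ) : IsDoubleDescentLetter τ x := by
  have := h.position_lt
  exact ⟨(h.lt_letter_target (by omega) (by omega)).not_gt, h.fallsFrom⟩

protected lemma reverse (h : Hop x σ τ) : Hop x (reverse τ) (reverse σ) := by
  have hσ := one_le_position σ x
  have hτ := position_le τ x
  have hlt := h.position_lt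
  refine ⟨?_, risesInto_reverse.2 h.fallsFrom, fallsFrom_reverse.2 h.risesInto, ?_, ?_, ?_⟩ <;>
    simp only [position_reverse, letter_reverse]
  · omega
  · intro k hk hk'
    exact h.lt_letter_target (by omega) (by omega)
  · intro k hk
    exact (h.letter_outside (by omega)).symm
  · intro k hk hk'
    rw [h.letter_shift (k := N + 1 - (k + 1)) (by omega) (by omega)]
    congr 1
    omega

lemma target_position_le {σ τ τ' : Equiv.Perm (Fin N)} (h : Hop x σ τ) (h' : Hop x σ τ') :
    position τ x ≤ position τ' x := by
  by_contra! hlt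
  have := h'.position_lt
  exact h'.letter_right_source.not_gt (h.lt_letter (by omega) hlt)

lemma target_unique {σ τ τ' : Equiv.Perm (Fin N)} (h : Hop x σ τ) (h' : Hop x σ τ') : τ = τ' := by
  have position_eq := le_antisymm (h.target_position_le h') (h'.target_position_le h)
  refine perm_eq_of_letter_eq fun k => ?_
  by_cases hout : k < position σ x ∨ position τ x < k
  · rw [h.letter_outside hout, h'.letter_outside (position_eq ▸ hout)]
  · rcases eq_or_ne k (position τ x) with rfl | hne
    · rw [letter_position, position_eq, letter_position]
    · rw [h.letter_shift (by omega) (by omega), h'.letter_shift (by omega) (by omega)]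

lemma source_unique {σ σ' τ : Equiv.Perm (Fin N)} (h : Hop x σ τ) (h' : Hop x σ' τ) : σ = σ' := by
  rw [← reverse_reverse σ, h.reverse.target_unique h'.reverse, reverse_reverse]

lemma position_cases (h : Hop x σ τ) (hv : v ≠ x) :
    (position σ v < position σ x ∧ position τ v = position σ v) ∨
    (position σ x < position σ v ∧ position σ v ≤ position τ x ∧ x < v ∧
      position τ v = position σ v - 1) ∨
    (position τ x < position σ v ∧ position τ v = position σ v) := by
  have hne : position σ v ≠ position σ x := (position_injective σ).ne hv
  have hv := letter_position σ v
  rcases hne.lt_or_gt with hlt | hgt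
  · refine Or.inl ⟨hlt, (letter_eq_iff.1 ?_).symm⟩
    rw [h.letter_outside (Or.inl hlt), hv]
  rcases le_or_gt (position σ v) (position τ x) with hle | hgt'
  · refine Or.inr (Or.inl ⟨hgt, hle, ?_, (letter_eq_iff.1 ?_).symm⟩)
    · have := h.lt_letter hgt hle
      exact Fin.lt_def.2 (by omega)
    · rw [h.letter_shift (by omega) (by omega), Nat.sub_add_cancel (one_le_position σ v), hv]
  · refine Or.inr (Or.inr ⟨hgt', (letter_eq_iff.1 ?_).symm⟩)
    rw [h.letter_outside (Or.inr hgt'), hv]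

lemma risesInto_iff_of_ne (h : Hop x σ τ) (hv : v ≠ x) : RisesInto τ v ↔ RisesInto σ v := by
  have hlt := h.position_lt
  have h1 := one_le_position σ x
  have hσx := letter_position σ x
  have hτx := letter_position τ x
  rcases h.position_cases hv with ⟨hpos, heq⟩ | ⟨hpos, hpos', hxv, heq⟩ | ⟨hpos, heq⟩ <;>
    unfold RisesInto <;> rw [heq]
  · rw [h.letter_outside (by omega)]
  · rcases eq_or_ne (position σ v) (position σ x + 1) with hnext | hne
    · have hleft : letter τ (position σ x - 1) < x + 1 := by
        rw [h.letter_outside (by omega)]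
        exact h.risesInto
      have := Fin.lt_def.1 hxv
      rw [hnext, Nat.add_sub_cancel, hσx]
      omega
    · rw [h.letter_shift (by omega) (by omega), Nat.sub_add_cancel (by omega)]
  · rcases eq_or_ne (position σ v) (position τ x + 1) with hnext | hne
    · have hright := h.letter_right_source
      rw [← hnext, letter_position] at hright
      have hlast := h.lt_letter hlt le_rfl
      rw [hnext, Nat.add_sub_cancel, hτx]
      omega
    · rw [h.letter_outside (by omega)]

lemma fallsFrom_iff_of_ne (h : Hop x σ τ) (hv : v ≠ x) : FallsFrom τ v ↔ FallsFrom σ v := by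
  rw [← risesInto_reverse, ← risesInto_reverse, h.reverse.risesInto_iff_of_ne hv]

lemma card_isValleyLetter (h : Hop x σ τ) :
    #{v | IsValleyLetter τ v} = #{v | IsValleyLetter σ v} := by
  refine congrArg card (filter_congr fun v _ => ?_)
  rcases eq_or_ne v x with rfl | hv
  · exact iff_of_false (fun hV => hV.2 h.fallsFrom) fun hV => hV.1 h.risesInto
  · rw [IsValleyLetter, h.risesInto_iff_of_ne hv, h.fallsFrom_iff_of_ne hv]

end Hop

/-! ### Invariance of `les`, `res` and `lema` -/

/-- The sum of the weights `e b c` of the first `k` steps `(b, c) = (σ_m, σ_{m+1})`, `m ≥ 0`, of the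
word of `σ`. -/
def stepSum {M : Type*} [AddCommMonoid M] (e : ℕ → ℕ → M) (σ : Equiv.Perm (Fin N)) (k : ℕ) : M :=
  ∑ m ∈ range k, e (letter σ m) (letter σ (m + 1))

/-- A step weight that does not change when `a` is inserted into an ascending or descending step
across `a`. -/
structure IsTransparent {M : Type*} [AddCommMonoid M] (e : ℕ → ℕ → M) (a : ℕ) : Prop where
  ascent ⦃b c : ℕ⦄ : b < a → a < c → e b a + e a c = e b c
  descent ⦃b c : ℕ⦄ : b < a → a < c → e c a + e a b = e c b

/-- The indicator of a descent from `b` to `c` across the level `l`. -/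
def downCross (l b c : ℕ) : ℕ := if c < l ∧ l < b then 1 else 0

lemma isTransparent_downCross {l a : ℕ} (hla : l ≠ a) : IsTransparent (downCross l) a := by
  constructor <;> intro b c hb hc <;> unfold downCross <;> split_ifs <;> omega

section StepSum

variable {M : Type*} [AddCommMonoid M] {e : ℕ → ℕ → M}

lemma stepSum_succ (e : ℕ → ℕ → M) (σ : Equiv.Perm (Fin N)) (k : ℕ) :
    stepSum e σ (k + 1) = stepSum e σ k + e (letter σ k) (letter σ (k + 1)) :=
  sum_range_succ _ k

lemma stepSum_of_pos (e : ℕ → ℕ → M) (σ : Equiv.Perm (Fin N)) (hk : 0 < k) :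
    stepSum e σ k = stepSum e σ (k - 1) + e (letter σ (k - 1)) (letter σ k) := by
  obtain ⟨k, rfl⟩ := Nat.exists_eq_add_of_le' hk
  exact stepSum_succ e σ k

lemma stepSum_eq_of_forall_eq_zero {k l : ℕ} (hkl : k ≤ l)
    (h : ∀ m, k ≤ m → m < l → e (letter σ m) (letter σ (m + 1)) = 0) :
    stepSum e σ l = stepSum e σ k := by
  refine (sum_subset (range_mono hkl) fun m hm hm' => h m ?_ (mem_range.1 hm)).symm
  simpa only [mem_range, not_lt] using hm'

namespace Hop

lemma stepSum_of_lt (h : Hop x σ τ) (hk : k < position σ x) : stepSum e τ k = stepSum e σ k := by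
  refine sum_congr rfl fun m hm => ?_
  have := mem_range.1 hm
  rw [h.letter_outside (by omega), h.letter_outside (by omega)]

lemma stepSum_of_mem (h : Hop x σ τ) (he : IsTransparent e (x + 1)) (hk : position σ x ≤ k)
    (hk' : k < position τ x) : stepSum e τ k = stepSum e σ (k + 1) := by
  induction k, hk using Nat.le_induction with
  | base =>
    have habove := h.lt_letter (k := position σ x + 1) (by omega) h.position_lt
    have hpos := one_le_position σ x
    rw [stepSum_of_pos e τ hpos, h.stepSum_of_lt (by omega),
      h.letter_outside (by omega), h.letter_shift le_rfl h.position_lt, stepSum_succ,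
      stepSum_of_pos e σ hpos, letter_position, add_assoc,
      he.ascent h.risesInto habove]
  | succ k hk ih =>
    rw [stepSum_succ, stepSum_succ e σ (k + 1), ih (by omega), h.letter_shift hk (by omega),
      h.letter_shift (by omega) hk']

lemma stepSum_of_gt (h : Hop x σ τ) (he : IsTransparent e (x + 1)) (hk : position τ x < k) :
    stepSum e τ k = stepSum e σ k := by
  induction k, Nat.succ_le_of_lt hk using Nat.le_induction with
  | base =>
    have hlt := h.position_lt
    have hlast := h.lt_letter hlt le_rfl
    have hpred := Nat.sub_add_cancel (one_le_position τ x)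
    rw [Nat.succ_eq_add_one, stepSum_succ, stepSum_of_pos e τ (one_le_position τ x),
      h.stepSum_of_mem he (by omega) (by omega), h.letter_shift (by omega) (by omega), hpred,
      letter_position, h.letter_outside (by omega), stepSum_succ, add_assoc,
      he.descent h.letter_right_source hlast]
  | succ k hk ih =>
    rw [stepSum_succ, stepSum_succ, ih (by omega), h.letter_outside (by omega),
      h.letter_outside (by omega)]

lemma stepSum_position_eq (h : Hop x σ τ) (he : IsTransparent e (x + 1)) (hv : v ≠ x) :
    stepSum e τ (position τ v) = stepSum e σ (position σ v) := by
  rcases h.position_cases hv with ⟨hpos, heq⟩ | ⟨hpos, hpos', -, heq⟩ | ⟨hpos, heq⟩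
  · rw [heq, h.stepSum_of_lt hpos]
  · rw [heq, h.stepSum_of_mem he (by omega) (by omega),
      Nat.sub_add_cancel (one_le_position σ v)]
  · rw [heq, h.stepSum_of_gt he hpos]

end Hop

end StepSum

lemma downCross_of_le {l b c : ℕ} (h : l ≤ c) : downCross l b c = 0 :=
  if_neg fun h' => h.not_gt h'.1

lemma les_eq_sum_stepSum (σ : Equiv.Perm (Fin N)) :
    les σ = ∑ v : Fin N, stepSum (downCross (v + 1)) σ (position σ v) := by
  simp only [stepSum, downCross, ← card_filter, ← card_sigma]
  symm
  refine card_bij (fun a _ => (a.2 + 1, position σ a.1)) ?_ ?_ ?_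
  · rintro ⟨v, m⟩ hm
    simp only [mem_sigma, mem_univ, true_and, mem_filter, mem_range, mem_product, mem_Icc,
      Nat.add_sub_cancel, letter_position] at hm ⊢
    have := letter_pos_iff.1 (Nat.zero_lt_of_lt hm.2.2)
    have := position_le σ v
    have : m + 1 ≠ position σ v := fun h => by
      rw [h, letter_position] at hm
      omega
    omega
  · rintro ⟨v, m⟩ - ⟨w, l⟩ - h
    obtain ⟨h₁, h₂⟩ := Prod.mk.inj h
    obtain rfl := position_injective σ h₂
    obtain rfl := Nat.succ_injective h₁
    rfl
  · rintro ⟨i, j⟩ hij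
    simp only [mem_filter, mem_product, mem_Icc] at hij
    obtain ⟨⟨hi, hj⟩, hlt, hcross⟩ := hij
    obtain ⟨v, rfl⟩ := exists_position_eq σ (by omega) hj.2
    rw [letter_position] at hcross
    have hi' : i - 1 + 1 = i := Nat.sub_add_cancel (by omega)
    refine ⟨⟨v, i - 1⟩, ?_, by rw [hi']⟩
    simp only [mem_sigma, mem_univ, true_and, mem_filter, mem_range, hi']
    exact ⟨by omega, hcross.2, hcross.1⟩

lemma res_eq_les_reverse (σ : Equiv.Perm (Fin N)) : res σ = les (reverse σ) := by
  refine card_nbij' (fun a => (N + 1 - a.2, N + 1 - a.1)) (fun a => (N + 1 - a.2, N + 1 - a.1))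
    ?_ ?_ ?_ ?_ <;> rintro ⟨i, j⟩ hij <;>
    simp only [coe_filter, mem_product, mem_Ico, mem_Icc, Set.mem_ofPred_eq, letter_reverse,
      Prod.mk.injEq] at hij ⊢
  · rw [show N + 1 - (N + 1 - j - 1) = j + 1 by omega, show N + 1 - (N + 1 - j) = j by omega,
      show N + 1 - (N + 1 - i) = i by omega]
    omega
  · rw [show N + 1 - i + 1 = N + 1 - (i - 1) by omega]
    omega
  all_goals omega

lemma isLeftToRightMax_position_iff :
    IsLeftToRightMax σ (position σ v) ↔ ∀ w, position σ w < position σ v → w < v := by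
  refine ⟨fun h w hw => ?_, fun h k hk => ?_⟩
  · have := h _ (mem_Ico.2 ⟨one_le_position σ w, hw⟩)
    rw [letter_position, letter_position] at this
    exact Fin.lt_def.2 (by omega)
  · obtain ⟨h1, hlt⟩ := mem_Ico.1 hk
    obtain ⟨w, rfl⟩ := exists_position_eq σ h1 (hlt.le.trans (position_le σ v))
    have := Fin.lt_def.1 (h w hlt)
    rw [letter_position, letter_position]
    omega

lemma lema_eq_card (σ : Equiv.Perm (Fin N)) :
    lema σ = #{v | (∀ w, position σ w < position σ v → w < v) ∧ Even ((v : ℕ) + 1)} := by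
  simp only [lema, card_filter_Icc_eq_card_filter_position σ, isLeftToRightMax_position_iff,
    letter_position]

namespace Hop

lemma les_eq (h : Hop x σ τ) : les τ = les σ := by
  rw [les_eq_sum_stepSum, les_eq_sum_stepSum]
  refine sum_congr rfl fun v _ => ?_
  rcases eq_or_ne v x with rfl | hv
  · have hlt := h.position_lt
    calc stepSum (downCross (v + 1)) τ (position τ v)
        = stepSum (downCross (v + 1)) τ (position σ v - 1) := by
          refine stepSum_eq_of_forall_eq_zero (by omega) fun m hm hm' => downCross_of_le ?_
          rcases eq_or_ne (m + 1) (position τ v) with heq | hne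
          · rw [heq, letter_position]
          · exact (h.lt_letter_target (by omega) (by omega)).le
      _ = stepSum (downCross (v + 1)) σ (position σ v - 1) :=
          h.stepSum_of_lt (Nat.sub_lt (one_le_position σ v) one_pos)
      _ = stepSum (downCross (v + 1)) σ (position σ v) := by
          refine (stepSum_eq_of_forall_eq_zero (Nat.sub_le _ 1) fun m hm hm' => ?_).symm
          rw [show m + 1 = position σ v by omega, letter_position, downCross_of_le le_rfl]
  · exact h.stepSum_position_eq
      (isTransparent_downCross (by rwa [Ne, add_left_inj, ← Fin.ext_iff])) hv

lemma res_eq (h : Hop x σ τ) : res τ = res σ := by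
  rw [res_eq_les_reverse, res_eq_les_reverse, h.reverse.les_eq]

lemma forall_position_lt_iff (h : Hop x σ τ) (hv : v ≠ x) :
    (∀ w, position τ w < position τ v → w < v) ↔ ∀ w, position σ w < position σ v → w < v := by
  have hlt := h.position_lt
  refine forall_congr' fun w => ?_
  rcases eq_or_ne w x with rfl | hw
  · rcases h.position_cases hv with hpos | ⟨-, -, hxv, -⟩ | hpos
    · exact imp_congr_left (by omega)
    · exact iff_of_true (fun _ => hxv) fun _ => hxv
    · exact imp_congr_left (by omega)
  · refine imp_congr_left ?_
    rcases h.position_cases hv with hpos | hpos | hpos <;>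
      rcases h.position_cases hw with hpos' | hpos' | hpos' <;> omega

lemma lema_eq (h : Hop x σ τ) (hx : Odd ((x : ℕ) + 1)) : lema τ = lema σ := by
  rw [lema_eq_card, lema_eq_card]
  refine congrArg card (filter_congr fun v _ => ?_)
  rcases eq_or_ne v x with rfl | hv
  · simp only [Nat.not_even_iff_odd.2 hx, and_false]
  · rw [h.forall_position_lt_iff hv]

end Hop

/-! ### Valley hopping -/

open Classical in
/-- The valley hop of the letter `x + 1`: a double ascent hops right across the block of larger
letters after it, a double descent hops left across the block of larger letters before it, and a
peak or a valley stays where it is. -/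
noncomputable def valleyHop (x : Fin N) (σ : Equiv.Perm (Fin N)) : Equiv.Perm (Fin N) :=
  if h : ∃ τ, Hop x σ τ ∨ Hop x τ σ then h.choose else σ

lemma exists_hop_of_isDoubleDescentLetter (hD : IsDoubleDescentLetter σ x) : ∃ τ, Hop x τ σ := by
  have hA : IsDoubleAscentLetter (reverse σ) x := by
    rwa [IsDoubleAscentLetter, risesInto_reverse, fallsFrom_reverse, and_comm]
  obtain ⟨τ, h⟩ := exists_hop_of_isDoubleAscentLetter hA
  exact ⟨reverse τ, reverse_reverse σ ▸ h.reverse⟩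

namespace Hop

lemma valleyHop_source (h : Hop x σ τ) : valleyHop x σ = τ := by
  have hex : ∃ τ, Hop x σ τ ∨ Hop x τ σ := ⟨τ, Or.inl h⟩
  rw [valleyHop, dif_pos hex]
  refine hex.choose_spec.elim (fun h' => h'.target_unique h) fun h' => ?_
  exact absurd h.risesInto h'.isDoubleDescentLetter.1

lemma valleyHop_target (h : Hop x σ τ) : valleyHop x τ = σ := by
  have hex : ∃ ρ, Hop x τ ρ ∨ Hop x ρ τ := ⟨σ, Or.inr h⟩
  rw [valleyHop, dif_pos hex]
  refine hex.choose_spec.elim (fun h' => ?_) fun h' => h'.source_unique h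
  exact absurd h'.risesInto h.isDoubleDescentLetter.1

end Hop

lemma valleyHop_cases (x : Fin N) (σ : Equiv.Perm (Fin N)) :
    Hop x σ (valleyHop x σ) ∨ Hop x (valleyHop x σ) σ ∨
      (¬ IsDoubleAscentLetter σ x ∧ ¬ IsDoubleDescentLetter σ x ∧ valleyHop x σ = σ) := by
  by_cases hex : ∃ τ, Hop x σ τ ∨ Hop x τ σ
  · rw [← or_assoc, valleyHop, dif_pos hex]
    exact Or.inl hex.choose_spec
  · refine Or.inr (Or.inr ⟨fun hA => hex ?_, fun hD => hex ?_, dif_neg hex⟩)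
    · exact (exists_hop_of_isDoubleAscentLetter hA).imp fun _ => Or.inl
    · exact (exists_hop_of_isDoubleDescentLetter hD).imp fun _ => Or.inr

lemma valleyHop_invariant {β : Sort*} {f : Equiv.Perm (Fin N) → β}
    (hf : ∀ σ τ, Hop x σ τ → f τ = f σ) (σ : Equiv.Perm (Fin N)) : f (valleyHop x σ) = f σ := by
  rcases valleyHop_cases x σ with h | h | ⟨-, -, h⟩
  · exact hf _ _ h
  · exact (hf _ _ h).symm
  · rw [h]

lemma isHopSystem_valleyHop :
    IsHopSystem (valleyHop (N := N)) IsDoubleAscentLetter IsDoubleDescentLetter where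
  involutive x σ := by
    rcases valleyHop_cases x σ with h | h | ⟨-, -, h⟩
    · exact h.valleyHop_target
    · exact h.valleyHop_source
    · rw [h, h]
  exchange x σ := by
    rcases valleyHop_cases x σ with h | h | ⟨hA, hD, h⟩
    · exact iff_of_true h.isDoubleDescentLetter h.isDoubleAscentLetter
    · exact iff_of_false (fun hD => hD.1 h.risesInto) fun hA => h.isDoubleDescentLetter.1 hA.1
    · exact h.symm ▸ iff_of_false hD hA
  left_iff_of_ne {_ v} hv σ := Eq.to_iff <|
    valleyHop_invariant (f := fun σ => IsDoubleAscentLetter σ v) (fun σ τ h => by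
      simp only [IsDoubleAscentLetter, h.risesInto_iff_of_ne hv, h.fallsFrom_iff_of_ne hv]) σ
  right_iff_of_ne {_ v} hv σ := Eq.to_iff <|
    valleyHop_invariant (f := fun σ => IsDoubleDescentLetter σ v) (fun σ τ h => by
      simp only [IsDoubleDescentLetter, h.risesInto_iff_of_ne hv, h.fallsFrom_iff_of_ne hv]) σ
  disjoint hA hD := hD.1 hA.1

lemma les_valleyHop (x : Fin N) (σ : Equiv.Perm (Fin N)) : les (valleyHop x σ) = les σ :=
  valleyHop_invariant (fun _ _ => Hop.les_eq) σ

lemma res_valleyHop (x : Fin N) (σ : Equiv.Perm (Fin N)) : res (valleyHop x σ) = res σ :=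
  valleyHop_invariant (fun _ _ => Hop.res_eq) σ

lemma lema_valleyHop (hx : Odd ((x : ℕ) + 1)) (σ : Equiv.Perm (Fin N)) :
    lema (valleyHop x σ) = lema σ :=
  valleyHop_invariant (fun _ _ h => h.lema_eq hx) σ

lemma card_isValleyLetter_valleyHop (x : Fin N) (σ : Equiv.Perm (Fin N)) :
    #{v | IsValleyLetter (valleyHop x σ) v} = #{v | IsValleyLetter σ v} :=
  valleyHop_invariant (f := fun σ => #{v | IsValleyLetter σ v})
    (fun _ _ h => h.card_isValleyLetter) σ

end Words

section Expansion

variable {n : ℕ} {σ : Equiv.Perm (Fin (2 * n + 1))}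

/-- The odd letters of `{1, …, 2n+1}`, in the encoding of letters by `Fin (2 * n + 1)`. -/
def oddLetters (n : ℕ) : Finset (Fin (2 * n + 1)) := {v | Odd ((v : ℕ) + 1)}

lemma mem_oddLetters {v : Fin (2 * n + 1)} : v ∈ oddLetters n ↔ Odd ((v : ℕ) + 1) := by
  simp [oddLetters]

lemma card_oddLetters (n : ℕ) : #(oddLetters n) = n + 1 := by
  rw [oddLetters, card_filter, Fin.sum_univ_eq_sum_range (fun k => if Odd (k + 1) then 1 else 0)]
  induction n with
  | zero => decide
  | succ n ih =>
    rw [show 2 * (n + 1) + 1 = 2 * n + 1 + 1 + 1 by ring, sum_range_succ, sum_range_succ, ih,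
      if_neg (by grind), if_pos (by grind)]

lemma mem_Ystar_iff : σ ∈ Ystar n ↔ ∀ v ∉ oddLetters n, IsDoubleAscentLetter σ v := by
  have tops := forall_descentTop_iff (σ := σ) (Nat.succ_pos (2 * n)) Odd
  have bottoms := forall_descentBottom_iff (σ := σ) Odd
  simp only [Ystar, mem_filter_univ, imp_and, forall_and, and_right_comm, tops, bottoms,
    mem_oddLetters, not_imp_not]
  rw [and_comm]
  exact and_congr_left' (forall_congr' fun v => not_imp_comm)

lemma valleyHop_mem_Ystar {x : Fin (2 * n + 1)} (hx : x ∈ oddLetters n) (hσ : σ ∈ Ystar n) :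
    valleyHop x σ ∈ Ystar n := by
  rw [mem_Ystar_iff] at hσ ⊢
  intro v hv
  rw [isHopSystem_valleyHop.left_iff_of_ne (ne_of_mem_of_not_mem hx hv).symm]
  exact hσ v hv

lemma filter_oddLetters_eq (hσ : σ ∈ Ystar n) {P : Fin (2 * n + 1) → Prop} [DecidablePred P]
    (hP : ∀ v, P v → ¬ IsDoubleAscentLetter σ v) :
    {v ∈ oddLetters n | P v} = ({v | P v} : Finset _) := by
  ext v
  simp only [mem_filter, mem_univ, true_and, and_iff_right_iff_imp]
  intro hv
  by_contra hodd
  exact hP v hv (mem_Ystar_iff.1 hσ v hodd)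

lemma dd_eq_card_oddLetters (hσ : σ ∈ Ystar n) :
    dd σ = #{v ∈ oddLetters n | IsDoubleDescentLetter σ v} := by
  rw [dd_eq_card, filter_oddLetters_eq hσ fun v hD hA => hD.1 hA.1]

lemma mem_FPerm_iff : σ ∈ FPerm n ↔ σ ∈ Ystar n ∧ ∀ v, ¬ IsDoubleDescentLetter σ v := by
  rw [FPerm, mem_filter, forall_mem_Icc_iff_forall_position σ]
  simp only [isDoubleDescent_position_iff]
  refine and_congr_right fun _ => and_iff_left_of_imp fun hD => ?_
  obtain ⟨v, hv⟩ := exists_position_eq σ (Nat.succ_pos (2 * n)) le_rfl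
  have falls : FallsFrom σ v := by
    rw [FallsFrom, hv, ← letter_position σ v, hv]
    exact letter_length_add_one_lt (Nat.succ_pos _) σ
  have rises : RisesInto σ v := by
    by_contra hr
    exact hD v ⟨hr, falls⟩
  rw [RisesInto, ← letter_position σ v, hv] at rises
  rw [FallsFrom, ← letter_position σ v, hv] at falls
  exact ⟨rises, falls⟩

lemma mem_FPerm_iff_forall_oddLetters :
    σ ∈ FPerm n ↔ σ ∈ Ystar n ∧ ∀ v ∈ oddLetters n, ¬ IsDoubleDescentLetter σ v := by
  rw [mem_FPerm_iff]
  refine and_congr_right fun hσ => ⟨fun h v _ => h v, fun h v hD => ?_⟩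
  exact h v (by_contra fun hv => hD.1 (mem_Ystar_iff.1 hσ v hv).1) hD

lemma dd_eq_zero_of_mem_FPerm (hσ : σ ∈ FPerm n) : dd σ = 0 := by
  rw [dd_eq_card, card_eq_zero, filter_eq_empty_iff]
  exact fun v _ => (mem_FPerm_iff.1 hσ).2 v

lemma two_mul_des_add_card (hσ : σ ∈ FPerm n) :
    2 * des σ + #{v ∈ oddLetters n | IsDoubleAscentLetter σ v} = n := by
  have hY := (mem_FPerm_iff.1 hσ).1
  have descentTops : #{v ∈ oddLetters n | FallsFrom σ v} = des σ + 1 := by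
    rw [filter_oddLetters_eq hY fun v hF hA => hA.2 hF, card_fallsFrom (Nat.succ_pos _)]
  have valleys : #{v ∈ oddLetters n | IsValleyLetter σ v} = des σ := by
    rw [filter_oddLetters_eq hY fun v hV hA => hV.1 hA.1, des_eq_card_valley_add_dd,
      dd_eq_zero_of_mem_FPerm hσ, add_zero]
  have nonTops : #{v ∈ oddLetters n | IsDoubleAscentLetter σ v} +
      #{v ∈ oddLetters n | IsValleyLetter σ v} = #{v ∈ oddLetters n | ¬ FallsFrom σ v} := by
    rw [← card_filter_add_card_filter_not (s := {v ∈ oddLetters n | ¬ FallsFrom σ v})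
      (RisesInto σ)]
    simp only [filter_filter, and_comm]
  have := card_filter_add_card_filter_not (s := oddLetters n) (fun v => FallsFrom σ v)
  have := card_oddLetters n
  omega

theorem sum_Ystar_eq_sum_FPerm {R : Type*} [CommSemiring R]
    {f : Equiv.Perm (Fin (2 * n + 1)) → R}
    (hf : ∀ x ∈ oddLetters n, ∀ σ, f (valleyHop x σ) = f σ) (y t : R) :
    ∑ σ ∈ Ystar n, f σ * y ^ dd σ * t ^ des σ =
      ∑ σ ∈ FPerm n, f σ * t ^ des σ * (1 + y * t) ^ (n - 2 * des σ) := by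
  calc ∑ σ ∈ Ystar n, f σ * y ^ dd σ * t ^ des σ
      = ∑ σ ∈ Ystar n, f σ * t ^ #{v | IsValleyLetter σ v} *
          (y * t) ^ #{v ∈ oddLetters n | IsDoubleDescentLetter σ v} := by
        refine sum_congr rfl fun σ hσ => ?_
        rw [← dd_eq_card_oddLetters hσ, des_eq_card_valley_add_dd]
        ring
    _ = ∑ σ ∈ FPerm n, f σ * t ^ #{v | IsValleyLetter σ v} *
          (1 + y * t) ^ #{v ∈ oddLetters n | IsDoubleAscentLetter σ v} := by
        rw [isHopSystem_valleyHop.sum_mul_pow_card_eq (oddLetters n)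
          (w := fun σ => f σ * t ^ #{v | IsValleyLetter σ v})
          (fun x hx σ => valleyHop_mem_Ystar hx)
          (fun x hx σ => by rw [hf x hx, card_isValleyLetter_valleyHop])]
        refine sum_congr (ext fun σ => ?_) fun _ _ => rfl
        simp only [mem_filter, mem_FPerm_iff_forall_oddLetters]
    _ = ∑ σ ∈ FPerm n, f σ * t ^ des σ * (1 + y * t) ^ (n - 2 * des σ) := by
        refine sum_congr rfl fun σ hσ => ?_
        have doubleAscents := Nat.eq_sub_of_add_eq' (two_mul_des_add_card hσ)
        rw [doubleAscents, des_eq_card_valley_add_dd, dd_eq_zero_of_mem_FPerm hσ, add_zero]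

end Expansion

end OddOdd

theorem mainTheorem6_general {R : Type*} [CommSemiring R] (n : ℕ)
    (f : Equiv.Perm (Fin (2 * n + 1)) → R)
    (hf : ∀ x ∈ OddOdd.oddLetters n, ∀ σ, f (OddOdd.valleyHop x σ) = f σ) (y t : R) :
    ∑ σ ∈ OddOdd.Ystar n, f σ * y ^ OddOdd.dd σ * t ^ OddOdd.des σ =
      ∑ k ∈ Finset.range (n / 2 + 1),
        (∑ σ ∈ OddOdd.FPermDes n k, f σ) * t ^ k * (1 + y * t) ^ (n - 2 * k) := by
  have des_mem_range : ∀ σ ∈ OddOdd.FPerm n, OddOdd.des σ ∈ Finset.range (n / 2 + 1) := by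
    intro σ hσ
    have := OddOdd.two_mul_des_add_card hσ
    rw [Finset.mem_range]
    omega
  rw [OddOdd.sum_Ystar_eq_sum_FPerm hf, ← Finset.sum_fiberwise_of_maps_to des_mem_range]
  refine Finset.sum_congr rfl fun k _ => ?_
  rw [mul_assoc, Finset.sum_mul]
  refine Finset.sum_congr rfl fun σ hσ => ?_
  rw [(Finset.mem_filter.1 hσ).2, mul_assoc]

theorem mainTheorem6 {R : Type*} [CommRing R] (n : ℕ) (a p q y t : R) :
    OddOdd.Y n a p q y t =
      ∑ k ∈ Finset.range (n / 2 + 1),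
        OddOdd.gammaCoeff n k a p q * t ^ k * (1 + y * t) ^ (n - 2 * k) :=
  mainTheorem6_general n _ (fun x hx σ => by
    rw [OddOdd.lema_valleyHop (OddOdd.mem_oddLetters.1 hx), OddOdd.res_valleyHop,
      OddOdd.les_valleyHop]) y t
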